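/- Work on $\mathbb{R}^2$ with Lebesgue measure; functions are real-valued and identified when equal almost everywhere. For $u\in L^1(\mathbb{R}^2)$ put $$|Du|=\sup\Big\{\int_{\mathbb{R}^2}u\,\mathrm{div}\,\phi\,dx:\ \phi\in C_c^\infty(\mathbb{R}^2,\mathbb{R}^2),\ |\phi(x)|\le 1\ \forall x\Big\},\qquad \|u\|_{BV}=\|u\|_{L^1}+|Du|,$$ and let $BV$ be the set of $u\in L^1(\mathbb{R}^2)$ with $|Du|<\infty$. Let $G$ be the space of real tempered distributions $w$ of the form $w=\mathrm{div}\,F$ with $F\in L^\infty(\mathbb{R}^2,\mathbb{R}^2)$, with norm $\|w\|_G=\inf\{\|F\|_\infty:\ w=\mathrm{div}\,F\}$, where $\|F\|_\infty$ is the essential supremum of the Euclidean norm $|F(x)|$. Let $\lambda,\mu>0$ and let $f\in BV$ satisfy $\|f\|_{BV}\le\frac{\mu}{4\lambda}$. Call $(u,v,w)$ an optimal three-part decomposition of $f$ if it minimizes $$\|u\|_{BV}+\lambda\|v\|_{L^2}^2+\mu\|w\|_G$$ among all triples with $u\in BV$, $v\in L^2(\mathbb{R}^2)$, $w\in G$ and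 $f=u+v+w$ (as tempered distributions). Call $(u,v)$ an optimal Rudin–Osher–Fatemi ($BV$–$L^2$) decomposition of $f$ if it minimizes $$\|u\|_{BV}+\lambda\|v\|_{L^2}^2$$ among all pairs with $u\in BV$, $v\in L^2(\mathbb{R}^2)$ and $f=u+v$. Then $f$ has exactly one optimal three-part decomposition and exactly one optimal Rudin–Osher–Fatemi decomposition, and the two coincide: a triple $(u,v,w)$ is an optimal three-part decomposition of $f$ if and only if $w=0$ and $(u,v)$ is an optimal Rudin–Osher–Fatemi decomposition of $f$. -/

import Mathlib

open MeasureTheory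
open scoped ContDiff ENNReal SchwartzMap

noncomputable section

namespace ImageDecomposition

/-- The plane `ℝ²` with its Euclidean norm and Lebesgue measure. -/
abbrev Plane : Type := EuclideanSpace ℝ (Fin 2)

/-- Real-valued measurable functions on the plane, modulo equality almost everywhere. -/
abbrev Img : Type := Plane →ₘ[(volume : Measure Plane)] ℝ

/-- Real tempered distributions on the plane: continuous linear functionals on the real-valued
Schwartz functions. -/
abbrev Tempered : Type := 𝓢(Plane, ℝ) →L[ℝ] ℝ

/-- The divergence `∂₁φ₁ + ∂₂φ₂` of a (differentiable) vector field. -/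
def divergence (φ : Plane → Plane) (x : Plane) : ℝ :=
  ∑ i : Fin 2, fderiv ℝ φ x (EuclideanSpace.single i 1) i

/-- Test fields for the total variation: `φ ∈ C_c^∞(ℝ², ℝ²)` with `|φ(x)| ≤ 1` for all `x`. -/
structure IsTestField (φ : Plane → Plane) : Prop where
  smooth : ContDiff ℝ ∞ φ
  compactSupport : HasCompactSupport φ
  norm_le_one : ∀ x, ‖φ x‖ ≤ 1

/-- The total variation `|Du| = sup {∫ u div φ}` over all test fields. Test fields are closed
under negation, so cutting negative values off at `0` does not change the supremum. -/
def totalVariation (u : Img) : ℝ≥0∞ :=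
  ⨆ (φ : Plane → Plane) (_ : IsTestField φ), ENNReal.ofReal (∫ x, u x * divergence φ x)

/-- `‖u‖_BV = ‖u‖_{L¹} + |Du|`. -/
def bvNorm (u : Img) : ℝ≥0∞ :=
  eLpNorm u 1 volume + totalVariation u

/-- `u ∈ BV(ℝ²)`: `u ∈ L¹` and `|Du| < ∞`. -/
def IsBV (u : Img) : Prop :=
  MemLp u 1 volume ∧ totalVariation u < ⊤

/-- `w = div F` in the sense of tempered distributions, i.e. `⟨w, φ⟩ = -∫ F · ∇φ`, for a
bounded vector field `F ∈ L^∞(ℝ², ℝ²)`. -/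
def IsDistribDiv (w : Tempered) (F : Lp Plane ⊤ (volume : Measure Plane)) : Prop :=
  ∀ φ : 𝓢(Plane, ℝ), w φ = -∫ x, fderiv ℝ φ x (F x)

/-- `w ∈ G`: `w` is the divergence of a bounded vector field. -/
def IsG (w : Tempered) : Prop :=
  ∃ F : Lp Plane ⊤ (volume : Measure Plane), IsDistribDiv w F

/-- `‖w‖_G = inf {‖F‖_∞ : w = div F}`, where `‖F‖_∞` is the essential supremum of the Euclidean
norm `|F(x)|`. -/
def gNorm (w : Tempered) : ℝ≥0∞ :=
  ⨅ (F : Lp Plane ⊤ (volume : Measure Plane)) (_ : IsDistribDiv w F), ‖F‖ₑ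

/-- `f = u + v + w` with `u ∈ BV`, `v ∈ L²`, `w ∈ G`; the sum is an identity of tempered
distributions, the functions `f, u, v` acting by integration. -/
structure IsDecomposition (f u v : Img) (w : Tempered) : Prop where
  bv : IsBV u
  memLp : MemLp v 2 volume
  memG : IsG w
  sum_eq : ∀ φ : 𝓢(Plane, ℝ),
    ∫ x, f x * φ x = (∫ x, u x * φ x) + (∫ x, v x * φ x) + w φ

/-- The energy `J(u,v,w) = ‖u‖_BV + lam ‖v‖²_{L²} + mu ‖w‖_G`. -/
def energy (lam mu : ℝ) (u v : Img) (w : Tempered) : ℝ≥0∞ :=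
  bvNorm u + ENNReal.ofReal lam * eLpNorm v 2 volume ^ 2 + ENNReal.ofReal mu * gNorm w

/-- `(u,v,w)` is an optimal three-part decomposition of `f`. -/
def IsOptimal (lam mu : ℝ) (f u v : Img) (w : Tempered) : Prop :=
  IsDecomposition f u v w ∧
    ∀ u' v' w', IsDecomposition f u' v' w' → energy lam mu u v w ≤ energy lam mu u' v' w'

/-- `f = u + v` with `u ∈ BV` and `v ∈ L²`. -/
structure IsROFDecomposition (f u v : Img) : Prop where
  bv : IsBV u
  memLp : MemLp v 2 volume
  sum_eq : f = u + v

/-- The Rudin–Osher–Fatemi (BV–L²) energy `‖u‖_BV + lam ‖v‖²_{L²}`. -/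
def rofEnergy (lam : ℝ) (u v : Img) : ℝ≥0∞ :=
  bvNorm u + ENNReal.ofReal lam * eLpNorm v 2 volume ^ 2

/-- `(u,v)` is an optimal Rudin–Osher–Fatemi decomposition of `f`. -/
def IsROFOptimal (lam : ℝ) (f u v : Img) : Prop :=
  IsROFDecomposition f u v ∧
    ∀ u' v', IsROFDecomposition f u' v' → rofEnergy lam u v ≤ rofEnergy lam u' v'

end ImageDecomposition

end

namespace ImageDecomposition

open Filter Topology Convolution

/-! Let `f = u + v + w`. If `‖u‖_BV > ‖f‖_BV`, the pair `(f, 0)` already has smaller energy, so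
suppose `‖u‖_BV ≤ ‖f‖_BV`. Put `g = f - u`, which is in `BV` and hence in `L²`; then `W = g - v` is
in `L²` and represents `w`. Expanding `v = g - W` gives `‖g‖² + ‖W‖² = ‖v‖² + 2∫Wg` in `L²`. Duality
bounds `∫Wg` by `|Dg| ‖w‖_G`, and `|Dg| ≤ ‖f‖_BV + ‖u‖_BV ≤ 2 · μ/(4λ)`, so `2λ∫Wg ≤ μ‖w‖_G`. Hence
moving `w` into the `L²` part lowers the energy by at least `λ‖W‖²`
(`IsDecomposition.rofEnergy_add_le_energy`), and an optimal triple has `W = 0`.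

The analytic input is smooth approximation of `BV` functions with control of the gradient
(`exists_seq_smooth_approx`). With the Sobolev inequality it yields `BV ⊂ L²`, and with a Fatou
argument the duality bound (`integral_mul_le_of_forall_smooth`). Existence and uniqueness for the
two-part problem come from uniform convexity of `v ↦ ‖f - v‖_BV + λ‖v‖²` on the Hilbert space `L²`
(`existsUnique_minimiser`); the three-part problem inherits both. -/

/-! ### Test fields, divergence and integration by parts. -/

theorem IsTestField.comp_add_right {φ : Plane → Plane} (hφ : IsTestField φ) (t : Plane) :
    IsTestField (fun x => φ (x + t)) where
  smooth := hφ.smooth.comp (contDiff_id.add contDiff_const)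
  compactSupport := hφ.compactSupport.comp_homeomorph (Homeomorph.addRight t)
  norm_le_one _ := hφ.norm_le_one _

theorem divergence_comp_add_right (φ : Plane → Plane) (t x : Plane) :
    divergence (fun y => φ (y + t)) x = divergence φ (x + t) := by
  simp only [divergence, fderiv_comp_add_right]

theorem continuous_divergence {φ : Plane → Plane} (hφ : ContDiff ℝ ∞ φ) :
    Continuous (divergence φ) := by
  have := hφ.continuous_fderiv (by simp)
  unfold divergence
  fun_prop

theorem hasCompactSupport_divergence {φ : Plane → Plane} (hφ : HasCompactSupport φ) :
    HasCompactSupport (divergence φ) := by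
  refine (hφ.fderiv ℝ).mono fun x hx => ?_
  contrapose! hx
  simp only [Function.mem_support, not_not] at hx ⊢
  simp [divergence, hx]

theorem continuousLinearMap_apply_eq_sum (L : Plane →L[ℝ] ℝ) (y : Plane) :
    L y = ∑ i : Fin 2, L (EuclideanSpace.single i 1) * y i := by
  conv_lhs => rw [← (EuclideanSpace.basisFun (Fin 2) ℝ).sum_repr y]
  simp [mul_comm]

theorem divergence_smul {χ : Plane → ℝ} {φ : Plane → Plane} (hχ : Differentiable ℝ χ)
    (hφ : Differentiable ℝ φ) (x : Plane) :
    divergence (fun y => χ y • φ y) x = χ x * divergence φ x + fderiv ℝ χ x (φ x) := by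
  rw [continuousLinearMap_apply_eq_sum]
  simp only [divergence, fderiv_fun_smul (hχ x) (hφ x), Finset.mul_sum, ← Finset.sum_add_distrib]
  simp

theorem fderiv_apply_coord {φ : Plane → Plane} (hφ : Differentiable ℝ φ) (x v : Plane)
    (i : Fin 2) : fderiv ℝ (fun y => φ y i) x v = fderiv ℝ φ x v i := by
  have := ((EuclideanSpace.proj (𝕜 := ℝ) i : Plane →L[ℝ] ℝ).hasFDerivAt.comp x
    (hφ x).hasFDerivAt).fderiv
  change fderiv ℝ (⇑(EuclideanSpace.proj (𝕜 := ℝ) i : Plane →L[ℝ] ℝ) ∘ φ) x v = _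
  rw [this]
  simp

theorem hasCompactSupport_coord {φ : Plane → Plane} (hφ : HasCompactSupport φ) (i : Fin 2) :
    HasCompactSupport (fun x => φ x i) :=
  hφ.comp_left (g := fun y : Plane => y i) rfl

/-- Integration by parts against a compactly supported smooth field. -/
theorem integral_mul_divergence {h : Plane → ℝ} {φ : Plane → Plane} (hh : ContDiff ℝ ∞ h)
    (hφ : ContDiff ℝ ∞ φ) (hφc : HasCompactSupport φ) :
    ∫ x, h x * divergence φ x = -∫ x, fderiv ℝ h x (φ x) := by
  have hd : Differentiable ℝ φ := hφ.differentiable (by simp)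
  have hφ' := hφ.continuous_fderiv (by simp)
  have hh' := hh.continuous_fderiv (by simp)
  have hc := hφ.continuous
  have hhc := hh.continuous
  have hi : ∀ i : Fin 2, HasCompactSupport (fun x => φ x i) := hasCompactSupport_coord hφc
  have hi' : ∀ i : Fin 2, HasCompactSupport
      (fun x => fderiv ℝ (fun y => φ y i) x (EuclideanSpace.single i 1)) := fun i =>
    ((hi i).fderiv ℝ).comp_left (g := fun L : Plane →L[ℝ] ℝ => L (EuclideanSpace.single i 1)) rfl
  have hci : ∀ i : Fin 2, Continuous
      (fun x => fderiv ℝ (fun y => φ y i) x (EuclideanSpace.single i 1)) := fun i => by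
    simp only [fderiv_apply_coord hd]
    fun_prop
  have e1 : ∀ i : Fin 2, Integrable (fun x =>
      h x * fderiv ℝ (fun y => φ y i) x (EuclideanSpace.single i 1)) := fun i =>
    (hhc.mul (hci i)).integrable_of_hasCompactSupport (hi' i).mul_left
  have e2 : ∀ i : Fin 2, Integrable (fun x =>
      fderiv ℝ h x (EuclideanSpace.single i 1) * φ x i) := fun i =>
    Continuous.integrable_of_hasCompactSupport (by fun_prop) (hi i).mul_left
  have e3 : ∀ i : Fin 2, Integrable (fun x => h x * φ x i) := fun i =>
    Continuous.integrable_of_hasCompactSupport (by fun_prop) (hi i).mul_left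
  simp only [continuousLinearMap_apply_eq_sum (fderiv ℝ h _) (φ _), divergence,
    ← fderiv_apply_coord hd, Finset.mul_sum]
  rw [integral_finsetSum _ fun i _ => e1 i, integral_finsetSum _ fun i _ => e2 i,
    ← Finset.sum_neg_distrib]
  refine Finset.sum_congr rfl fun i _ => ?_
  refine integral_mul_fderiv_eq_neg_fderiv_mul_of_integrable (e2 i) (e1 i) (e3 i)
    (fun x _ => hh.differentiable (by simp) x) (fun x _ => ?_)
  exact ((EuclideanSpace.proj (𝕜 := ℝ) i : Plane →L[ℝ] ℝ).differentiable.comp hd) x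

/-! ### Smooth approximation of functions of bounded variation. -/

/-- The total variation of a compactly supported smooth function is at least the `L¹` norm of its
derivative. -/
theorem integral_norm_fderiv_le {h : Plane → ℝ} {B : ℝ} (hh : ContDiff ℝ ∞ h)
    (hc : HasCompactSupport h)
    (hB : ∀ φ, IsTestField φ → ∫ x, h x * divergence φ x ≤ B) :
    ∫ x, ‖fderiv ℝ h x‖ ≤ B := by
  set G : Plane → Plane := fun x => (InnerProductSpace.toDual ℝ Plane).symm (fderiv ℝ h x) with hG
  have hGn : ∀ x, ‖G x‖ = ‖fderiv ℝ h x‖ := fun x => by simp [hG]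
  have hGi : ∀ x v, fderiv ℝ h x v = inner ℝ (G x) v := fun x v => by simp [hG]
  have hGs : ContDiff ℝ ∞ G :=
    (InnerProductSpace.toDual ℝ Plane).symm.toContinuousLinearEquiv.contDiff.comp
      (hh.fderiv_right (by simp))
  have hGc : HasCompactSupport G := (hc.fderiv ℝ).comp_left (by simp)
  have hint : Integrable (fun x => ‖G x‖) :=
    hGs.continuous.norm.integrable_of_hasCompactSupport hGc.norm
  simp only [← hGn]
  have hK := hc.isCompact
  -- The extremal field `-G/|G|` is not smooth where `G` vanishes, so `|G|` is replaced by `s =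
  -- √(|G|² + δ²)`. Since `|G| - |G|²/s ≤ δ`, and both sides of the comparison vanish off the
  -- support of `h`, the loss is at most `δ` times the measure of that support.
  have key : ∀ δ : ℝ, 0 < δ → ∫ x, ‖G x‖ ≤ B + δ * (volume.real (tsupport h)) := by
    intro δ hδ
    have hpos : ∀ x, 0 < ‖G x‖ ^ 2 + δ ^ 2 := fun x => by positivity
    set s : Plane → ℝ := fun x => √(‖G x‖ ^ 2 + δ ^ 2) with hs
    have hspos : ∀ x, 0 < s x := fun x => Real.sqrt_pos.2 (hpos x)
    have hss : ∀ x, s x ^ 2 = ‖G x‖ ^ 2 + δ ^ 2 := fun x => Real.sq_sqrt (hpos x).le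
    have hsG : ∀ x, ‖G x‖ ≤ s x := fun x => by
      rw [hs]; exact Real.le_sqrt_of_sq_le (by nlinarith [sq_nonneg δ])
    have hsG' : ∀ x, s x ≤ ‖G x‖ + δ := fun x => by
      rw [hs]
      exact Real.sqrt_le_iff.2 ⟨by positivity, by nlinarith [norm_nonneg (G x)]⟩
    have hsc : ContDiff ℝ ∞ s :=
      ((hGs.norm_sq ℝ).add contDiff_const).sqrt fun x => (hpos x).ne'
    have hsi : ContDiff ℝ ∞ fun x => (s x)⁻¹ := hsc.inv fun x => (hspos x).ne'
    have htest : IsTestField (fun x => -(s x)⁻¹ • G x) :=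
      { smooth := hsi.neg.smul hGs
        compactSupport := hGc.mono fun x hx hx' => hx (by simp [hx'])
        norm_le_one := fun x => by
          rw [norm_smul, norm_neg, norm_inv, Real.norm_of_nonneg (hspos x).le,
            inv_mul_le_one₀ (hspos x)]
          exact hsG x }
    have h1 := hB _ htest
    rw [integral_mul_divergence hh htest.smooth htest.compactSupport, ← integral_neg] at h1
    have h2 : ∀ x, -(fderiv ℝ h x) (-(s x)⁻¹ • G x) = ‖G x‖ ^ 2 * (s x)⁻¹ := fun x => by
      rw [hGi, inner_smul_right, real_inner_self_eq_norm_sq]; ring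
    simp only [h2] at h1
    have hi2 : Integrable (fun x => ‖G x‖ ^ 2 * (s x)⁻¹) := by
      refine Continuous.integrable_of_hasCompactSupport
        ((hGs.continuous.norm.pow 2).mul (hsc.continuous.inv₀ fun x => (hspos x).ne')) ?_
      refine HasCompactSupport.mul_right ?_
      exact hGc.comp_left (g := fun y : Plane => ‖y‖ ^ 2) (by simp)
    have hi3 : Integrable ((tsupport h).indicator fun _ => δ) :=
      (integrable_indicator_iff hK.measurableSet).2
        (integrableOn_const hK.measure_lt_top.ne)
    calc ∫ x, ‖G x‖ ≤ ∫ x, (‖G x‖ ^ 2 * (s x)⁻¹ + (tsupport h).indicator (fun _ => δ) x) := by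
          refine integral_mono hint (hi2.add hi3) fun x => ?_
          by_cases hx : x ∈ tsupport h
          · simp only [Set.indicator_of_mem hx]
            rw [← sub_le_iff_le_add', ← div_eq_mul_inv, sub_le_iff_le_add, ← sub_le_iff_le_add',
              le_div_iff₀ (hspos x)]
            nlinarith [hsG x, hsG' x, hspos x, norm_nonneg (G x)]
          · have : G x = 0 := by
              rw [hG]; simp only [image_eq_zero_of_notMem_tsupport
                (fun hx' => hx (tsupport_fderiv_subset ℝ hx')), map_zero]
            simp [this, Set.indicator_of_notMem hx]
      _ = (∫ x, ‖G x‖ ^ 2 * (s x)⁻¹) + δ * volume.real (tsupport h) := by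
          rw [integral_add hi2 hi3, integral_indicator hK.measurableSet, setIntegral_const,
            smul_eq_mul, mul_comm δ]
      _ ≤ _ := by gcongr
  refine le_of_forall_pos_le_add fun ε hε => ?_
  have hv : 0 < volume.real (tsupport h) + 1 := by positivity
  refine (key (ε / (volume.real (tsupport h) + 1)) (by positivity)).trans ?_
  gcongr
  rw [div_mul_eq_mul_div, div_le_iff₀ hv]
  nlinarith [measureReal_nonneg (μ := volume) (s := tsupport h)]

/-- Mollification does not increase the pairing with a test function, provided that all translates
of the test function satisfy the bound. -/
theorem integral_convolution_mul_le {g ψ : Plane → ℝ} {B : ℝ} (ρ : ContDiffBump (0 : Plane))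
    (hg : Integrable g) (hψ : Continuous ψ) (hψc : HasCompactSupport ψ)
    (hB : ∀ t, ∫ y, g y * ψ (y + t) ≤ B) :
    ∫ x, (ρ.normed volume ⋆[ContinuousLinearMap.lsmul ℝ ℝ, volume] g) x * ψ x ≤ B := by
  have hρ : Integrable (ρ.normed (volume : Measure Plane)) := ρ.integrable_normed
  obtain ⟨C, hC⟩ := hψc.exists_bound_of_continuous hψ
  have hint : Integrable (fun p : Plane × Plane =>
      (ρ.normed volume p.2 * g (p.1 - p.2)) * ψ p.1) (volume.prod volume) :=
    (hρ.convolution_integrand (ContinuousLinearMap.lsmul ℝ ℝ) hg).mul_bdd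
      (hψ.comp continuous_fst).aestronglyMeasurable (Eventually.of_forall fun p => hC p.1)
  -- Translation invariance moves the shift from `g` to `ψ`, so the mollified pairing is an average
  -- of pairings of `g` with translates of `ψ`.
  have e : ∀ t, ∫ x, (ρ.normed volume t * g (x - t)) * ψ x
      = ρ.normed volume t * ∫ y, g y * ψ (y + t) := fun t => by
    simp only [mul_assoc]
    rw [integral_const_mul, ← integral_add_right_eq_self _ t]
    simp
  calc ∫ x, (ρ.normed volume ⋆[ContinuousLinearMap.lsmul ℝ ℝ, volume] g) x * ψ x
      = ∫ x, ∫ t, (ρ.normed volume t * g (x - t)) * ψ x := by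
        simp only [convolution_def, ContinuousLinearMap.lsmul_apply, smul_eq_mul,
          integral_mul_const]
    _ = ∫ t, ρ.normed volume t * ∫ y, g y * ψ (y + t) := by
        rw [integral_integral_swap hint]
        simp only [e]
    _ ≤ ∫ t, ρ.normed volume t * B := by
        refine integral_mono ?_ (hρ.mul_const B) fun t =>
          mul_le_mul_of_nonneg_left (hB t) (ρ.nonneg_normed t)
        have := hint.integral_prod_right
        simpa only [e] using this
    _ = B := by rw [integral_mul_const, ρ.integral_normed, one_mul]

/-- Dilating one fixed bump by `n + 1` divides its gradient by `n + 1`, so truncating an `L¹`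
function adds arbitrarily little variation. -/
theorem exists_seq_cutoff :
    ∃ (C : ℝ) (χ : ℕ → Plane → ℝ), 0 ≤ C ∧ (∀ n, ContDiff ℝ ∞ (χ n)) ∧
      (∀ n, HasCompactSupport (χ n)) ∧ (∀ n x, ‖χ n x‖ ≤ 1) ∧
      (∀ n x, ‖fderiv ℝ (χ n) x‖ ≤ C / (n + 1)) ∧ ∀ x, ∀ᶠ n in atTop, χ n x = 1 := by
  let b : ContDiffBump (0 : Plane) := ⟨1, 2, one_pos, one_lt_two⟩
  have hbs : ContDiff ℝ ∞ b := b.contDiff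
  obtain ⟨C, hC⟩ := (b.hasCompactSupport.fderiv ℝ).exists_bound_of_continuous
    (hbs.continuous_fderiv (by simp))
  have hpos : ∀ n : ℕ, (0 : ℝ) < n + 1 := fun n => by positivity
  refine ⟨C, fun n x => b (((n : ℝ) + 1)⁻¹ • x), (norm_nonneg _).trans (hC 0), fun n => ?_,
    fun n => ?_, fun n x => ?_, fun n x => ?_, fun x => ?_⟩
  · exact hbs.comp (contDiff_id.const_smul _)
  · exact b.hasCompactSupport.comp_smul (inv_ne_zero (hpos n).ne')
  · rw [Real.norm_of_nonneg b.nonneg]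
    exact b.le_one
  · rw [fderiv_comp_smul, norm_smul, norm_inv, Real.norm_of_nonneg (hpos n).le, div_eq_inv_mul]
    gcongr
    exact hC _
  · obtain ⟨N, hN⟩ := exists_nat_ge ‖x‖
    filter_upwards [eventually_ge_atTop N] with n hn
    refine b.one_of_mem_closedBall ?_
    rw [mem_closedBall_zero_iff, norm_smul, norm_inv, Real.norm_of_nonneg (hpos n).le,
      inv_mul_le_one₀ (hpos n)]
    have : (N : ℝ) ≤ n := by exact_mod_cast hn
    linarith

/-- Smooth approximation of a function of bounded variation, with control of the derivative. -/
theorem exists_seq_smooth_approx {g : Plane → ℝ} {B ε : ℝ} (hg : Integrable g)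
    (hB : ∀ φ, IsTestField φ → ∫ x, g x * divergence φ x ≤ B) (hε : 0 < ε) :
    ∃ h : ℕ → Plane → ℝ, (∀ n, ContDiff ℝ ∞ (h n)) ∧ (∀ n, HasCompactSupport (h n)) ∧
      (∀ n, ∫ x, ‖fderiv ℝ (h n) x‖ ≤ B + ε) ∧
      ∀ᵐ x, Tendsto (fun n => h n x) atTop (𝓝 (g x)) := by
  obtain ⟨C, χ, hC, hχs, hχc, hχ1, hχd, hχ⟩ := exists_seq_cutoff
  let ρ : ℕ → ContDiffBump (0 : Plane) := fun n =>
    ⟨1 / ((n : ℝ) + 1), 2 * (1 / ((n : ℝ) + 1)), by positivity, by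
      have : 0 < 1 / ((n : ℝ) + 1) := by positivity
      linarith⟩
  have hρ : Tendsto (fun n => (ρ n).rOut) atTop (𝓝 0) := by
    have := tendsto_one_div_add_atTop_nhds_zero_nat (𝕜 := ℝ) |>.const_mul 2
    rwa [mul_zero] at this
  -- Starting the cutoffs at index `N` makes their cost `C‖g‖₁/(n + N + 1)` at most `ε` for every
  -- `n`.
  obtain ⟨N, hN⟩ := exists_nat_ge (C * (∫ x, ‖g x‖) / ε)
  have hae := ContDiffBump.ae_convolution_tendsto_right_of_locallyIntegrable (μ := volume)
    (K := 2) hρ (Eventually.of_forall fun n => le_rfl) hg.locallyIntegrable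
  have hsm : ∀ n, ContDiff ℝ ∞
      ((ρ n).normed volume ⋆[ContinuousLinearMap.lsmul ℝ ℝ, volume] g) := fun n =>
    (ρ n).hasCompactSupport_normed.contDiff_convolution_left _ (ρ n).contDiff_normed
      hg.locallyIntegrable
  refine ⟨fun n x => χ (n + N) x *
    ((ρ n).normed volume ⋆[ContinuousLinearMap.lsmul ℝ ℝ, volume] g) x,
    fun n => (hχs _).mul (hsm n), fun n => (hχc _).mul_right, fun n => ?_, ?_⟩
  · refine integral_norm_fderiv_le ((hχs _).mul (hsm n)) (hχc _).mul_right fun φ hφ => ?_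
    have hχtest : IsTestField (fun x => χ (n + N) x • φ x) :=
      { smooth := (hχs _).smul hφ.smooth
        compactSupport := (hχc _).smul_right
        norm_le_one := fun x => by
          rw [norm_smul]
          exact mul_le_one₀ (hχ1 _ x) (norm_nonneg _) (hφ.norm_le_one x) }
    have hdc := continuous_divergence hφ.smooth
    have hfd := (hχs (n + N)).continuous_fderiv (by simp)
    have hφc := hφ.smooth.continuous
    have hχcont := (hχs (n + N)).continuous
    have hmain := integral_convolution_mul_le (B := B + ε) (ρ n) hg (hχcont.mul hdc)
      (hχc (n + N)).mul_right fun t => ?_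
    · convert hmain using 2
      ext x
      simp only [Pi.mul_apply]
      ring
    · have hi1 : Integrable (fun y => g y * divergence (fun x => χ (n + N) (x + t) • φ (x + t)) y) := by
        have ht := hχtest.comp_add_right t
        obtain ⟨c, hc⟩ := (hasCompactSupport_divergence ht.compactSupport).exists_bound_of_continuous
          (continuous_divergence ht.smooth)
        exact hg.mul_bdd (continuous_divergence ht.smooth).aestronglyMeasurable
          (Eventually.of_forall hc)
      have hbd : ∀ y, ‖fderiv ℝ (χ (n + N)) (y + t) (φ (y + t))‖ ≤ C / ((n + N : ℕ) + 1) :=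
        fun y => ((fderiv ℝ (χ (n + N)) (y + t)).le_opNorm _).trans
          ((mul_le_of_le_one_right (norm_nonneg _) (hφ.norm_le_one _)).trans (hχd _ _))
      have hi2 : Integrable (fun y => g y * fderiv ℝ (χ (n + N)) (y + t) (φ (y + t))) := by
        refine hg.mul_bdd ?_ (Eventually.of_forall hbd)
        exact ((hfd.comp (continuous_add_const t)).clm_apply
          (hφc.comp (continuous_add_const t))).aestronglyMeasurable
      -- Product rule `χ div φ = div (χφ) - ∇χ · φ`: the first term is a test field, the second is
      -- the truncation error.
      have e : ∀ y, g y * (χ (n + N) (y + t) * divergence φ (y + t))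
          = g y * divergence (fun x => χ (n + N) (x + t) • φ (x + t)) y
            - g y * fderiv ℝ (χ (n + N)) (y + t) (φ (y + t)) := fun y => by
        rw [divergence_comp_add_right (fun x => χ (n + N) x • φ x),
          divergence_smul ((hχs _).differentiable (by simp))
            (hφ.smooth.differentiable (by simp))]
        ring
      simp only [Pi.mul_apply, e]
      rw [integral_sub hi1 hi2, sub_eq_add_neg]
      refine add_le_add (hB _ (hχtest.comp_add_right t)) ?_
      refine (neg_le_abs _).trans ?_
      rw [← Real.norm_eq_abs]
      refine (norm_integral_le_integral_norm _).trans ?_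
      calc ∫ y, ‖g y * fderiv ℝ (χ (n + N)) (y + t) (φ (y + t))‖
          ≤ ∫ y, ‖g y‖ * (C / ((n + N : ℕ) + 1)) := by
            refine integral_mono hi2.norm (hg.norm.mul_const _) fun y => ?_
            simp only [norm_mul (g y)]
            exact mul_le_mul_of_nonneg_left (hbd y) (norm_nonneg _)
        _ = (∫ y, ‖g y‖) * (C / ((n + N : ℕ) + 1)) := integral_mul_const _ _
        _ ≤ ε := by
            rw [div_le_iff₀ hε] at hN
            rw [← mul_div_assoc, div_le_iff₀ (by positivity), mul_comm]
            push_cast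
            nlinarith [(Nat.cast_nonneg n : (0 : ℝ) ≤ n)]
  · filter_upwards [hae] with x hx
    refine hx.congr' ?_
    filter_upwards [(tendsto_add_atTop_nat N).eventually (hχ x)] with n hn
    rw [hn, one_mul]

/-! ### The embedding of `BV` into `L²`. -/

/-- The Gagliardo–Nirenberg–Sobolev inequality in the plane. -/
theorem exists_eLpNorm_two_le :
    ∃ K : ℝ, 0 ≤ K ∧ ∀ h : Plane → ℝ, ContDiff ℝ ∞ h → HasCompactSupport h →
      eLpNorm h 2 volume ≤ ENNReal.ofReal (K * ∫ x, ‖fderiv ℝ h x‖) := by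
  have hp : NNReal.HolderConjugate (Module.finrank ℝ Plane) 2 := by
    rw [finrank_euclideanSpace_fin]
    exact_mod_cast (NNReal.HolderConjugate.two_two)
  refine ⟨eLpNormLESNormFDerivOneConst (volume : Measure Plane) 2, NNReal.coe_nonneg _,
    fun h hs hc => ?_⟩
  have := eLpNorm_le_eLpNorm_fderiv_one (volume : Measure Plane) (hs.of_le (by simp)) hc hp
  refine this.trans ?_
  rw [ENNReal.ofReal_mul (NNReal.coe_nonneg _), ENNReal.ofReal_coe_nnreal]
  rw [eLpNorm_one_eq_lintegral_enorm, ofReal_integral_norm_eq_lintegral_enorm]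
  · rfl
  · exact (hs.continuous_fderiv (by simp)).integrable_of_hasCompactSupport (hc.fderiv ℝ)

/-- Functions of bounded variation in the plane are square integrable. -/
theorem memLp_two_of_integral_mul_divergence_le {g : Plane → ℝ} {B : ℝ} (hg : Integrable g)
    (hB : ∀ φ, IsTestField φ → ∫ x, g x * divergence φ x ≤ B) : MemLp g 2 volume := by
  obtain ⟨K, hK, hsob⟩ := exists_eLpNorm_two_le
  obtain ⟨h, hs, hc, hd, hlim⟩ := exists_seq_smooth_approx hg hB one_pos
  refine ⟨hg.aestronglyMeasurable, ?_⟩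
  refine (Lp.eLpNorm_lim_le_liminf_eLpNorm
    (fun n => (hs n).continuous.aestronglyMeasurable) g hlim).trans_lt ?_
  refine lt_of_le_of_lt (liminf_le_of_frequently_le' (x := ENNReal.ofReal (K * (B + 1)))
    (Frequently.of_forall fun n => ?_)) ENNReal.ofReal_lt_top
  exact (hsob _ (hs n) (hc n)).trans
    (ENNReal.ofReal_le_ofReal (mul_le_mul_of_nonneg_left (hd n) hK))

/-! ### Duality between `BV` and divergences of bounded fields. -/

/-- Fatou's lemma, read as lower semicontinuity of the `L¹` norm under almost everywhere
convergence. -/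
theorem integral_le_of_tendsto_of_nonneg {F : ℕ → Plane → ℝ} {f : Plane → ℝ} {R : ℝ}
    (hF : ∀ n, Integrable (F n)) (h0 : ∀ n x, 0 ≤ F n x) (hf0 : ∀ x, 0 ≤ f x)
    (hf : Integrable f) (hR : ∀ n, ∫ x, F n x ≤ R)
    (hlim : ∀ᵐ x, Tendsto (fun n => F n x) atTop (𝓝 (f x))) : ∫ x, f x ≤ R := by
  have h := Lp.eLpNorm_lim_le_liminf_eLpNorm (p := 1)
    (fun n => (hF n).aestronglyMeasurable) f hlim
  have e : ∀ {k : Plane → ℝ}, Integrable k → (∀ x, 0 ≤ k x) →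
      eLpNorm k 1 volume = ENNReal.ofReal (∫ x, k x) := fun hk hk0 => by
    rw [eLpNorm_one_eq_lintegral_enorm, ← ofReal_integral_norm_eq_lintegral_enorm hk]
    simp only [Real.norm_of_nonneg (hk0 _)]
  have hR0 : 0 ≤ R := (integral_nonneg (h0 0)).trans (hR 0)
  rw [e hf hf0] at h
  rw [← ENNReal.ofReal_le_ofReal_iff hR0]
  refine h.trans (liminf_le_of_frequently_le' (Frequently.of_forall fun n => ?_))
  rw [e (hF n) (h0 n)]
  exact ENNReal.ofReal_le_ofReal (hR n)

theorem eLpNorm_two_sq_eq_ofReal {g : Plane → ℝ} (hg : MemLp g 2 volume) :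
    eLpNorm g 2 volume ^ 2 = ENNReal.ofReal (∫ x, g x ^ 2) := by
  have h := eLpNorm_nnreal_pow_eq_lintegral (f := g) (μ := volume) (p := 2) two_ne_zero
  norm_num at h
  rw [h, ofReal_integral_eq_lintegral_ofReal hg.integrable_sq
    (Eventually.of_forall fun x => sq_nonneg _)]
  refine lintegral_congr fun x => ?_
  rw [← ofReal_norm, ← ENNReal.ofReal_pow (norm_nonneg _), Real.norm_eq_abs, sq_abs]

theorem integral_sq_le {g : Plane → ℝ} {c : ℝ} (hg : MemLp g 2 volume) (hc : 0 ≤ c)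
    (h : eLpNorm g 2 volume ≤ ENNReal.ofReal c) : ∫ x, g x ^ 2 ≤ c ^ 2 := by
  rw [← ENNReal.ofReal_le_ofReal_iff (by positivity), ← eLpNorm_two_sq_eq_ofReal hg,
    ENNReal.ofReal_pow hc]
  gcongr

/-- Duality between functions of bounded variation and square-integrable functions that are
distributional divergences of bounded fields. -/
theorem integral_mul_le_of_forall_smooth {g W : Plane → ℝ} {B M : ℝ} (hg : Integrable g)
    (hB : ∀ φ, IsTestField φ → ∫ x, g x * divergence φ x ≤ B) (hW : MemLp W 2 volume)
    (hM : 0 ≤ M)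
    (hWM : ∀ h : Plane → ℝ, ContDiff ℝ ∞ h → HasCompactSupport h →
      ∫ x, W x * h x ≤ M * ∫ x, ‖fderiv ℝ h x‖) :
    ∫ x, W x * g x ≤ M * B := by
  obtain ⟨K, hK, hsob⟩ := exists_eLpNorm_two_le
  have hg2 := memLp_two_of_integral_mul_divergence_le hg hB
  have hWg : Integrable (fun x => W x * g x) := hW.integrable_mul hg2
  have hB0 : 0 ≤ B := by
    have := hB (fun _ => 0) ⟨contDiff_const, HasCompactSupport.zero, by simp⟩
    simpa [divergence] using this
  -- The approximants converge only almost everywhere, and `W h` has no sign. Adding `δh² + W²/(4δ)`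
  -- completes a square, so Fatou applies. The `W²` terms cancel, and the uniform bound `‖h‖₂ ≤ K(B
  -- + 1)` makes the remaining error of order `δ`.
  have key : ∀ δ : ℝ, 0 < δ → δ ≤ 1 →
      ∫ x, W x * g x ≤ M * B + δ * (M + (K * (B + 1)) ^ 2) := by
    intro δ hδ hδ1
    obtain ⟨h, hs, hc, hd, hlim⟩ := exists_seq_smooth_approx hg hB hδ
    have hh2 : ∀ n, MemLp (h n) 2 volume := fun n =>
      (hs n).continuous.memLp_of_hasCompactSupport (hc n)
    have hWh : ∀ n, Integrable (fun x => W x * h n x) := fun n => hW.integrable_mul (hh2 n)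
    have hint : ∀ {k : Plane → ℝ}, MemLp k 2 volume → Integrable (fun x => W x * k x) →
        Integrable (fun x => δ * k x ^ 2 + W x ^ 2 * (4 * δ)⁻¹ + W x * k x) ∧
        ∫ x, (δ * k x ^ 2 + W x ^ 2 * (4 * δ)⁻¹ + W x * k x)
          = δ * (∫ x, k x ^ 2) + (∫ x, W x ^ 2) * (4 * δ)⁻¹ + ∫ x, W x * k x := by
      intro k hk hWk
      have h1 := hk.integrable_sq.const_mul δ
      have h2 := hW.integrable_sq.mul_const (4 * δ)⁻¹
      refine ⟨(h1.add h2).add hWk, ?_⟩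
      rw [integral_add (by exact h1.add h2) hWk, integral_add h1 h2, integral_const_mul, integral_mul_const]
    have hnn : ∀ a b : ℝ, 0 ≤ δ * a ^ 2 + b ^ 2 * (4 * δ)⁻¹ + b * a := fun a b => by
      have : δ * a ^ 2 + b ^ 2 * (4 * δ)⁻¹ + b * a = δ * (a + b * (2 * δ)⁻¹) ^ 2 := by
        field_simp
        ring
      rw [this]
      positivity
    have hfatou := integral_le_of_tendsto_of_nonneg
      (R := δ * (K * (B + 1)) ^ 2 + (∫ x, W x ^ 2) * (4 * δ)⁻¹ + M * (B + δ))
      (fun n => (hint (hh2 n) (hWh n)).1) (fun n x => hnn _ _) (fun x => hnn (g x) (W x))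
      (hint hg2 hWg).1 (fun n => ?_) ?_
    · rw [(hint hg2 hWg).2] at hfatou
      have : 0 ≤ δ * ∫ x, g x ^ 2 := mul_nonneg hδ.le (integral_nonneg fun x => sq_nonneg _)
      linarith
    · rw [(hint (hh2 n) (hWh n)).2]
      gcongr
      · refine integral_sq_le (hh2 n) (by positivity) ((hsob _ (hs n) (hc n)).trans ?_)
        refine ENNReal.ofReal_le_ofReal (mul_le_mul_of_nonneg_left ((hd n).trans ?_) hK)
        linarith
      · exact (hWM _ (hs n) (hc n)).trans (mul_le_mul_of_nonneg_left (hd n) hM)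
    · filter_upwards [hlim] with x hx
      exact (((hx.pow 2).const_mul δ).add_const _).add (hx.const_mul _)
  refine le_of_forall_pos_le_add fun ε hε => ?_
  have hL : 0 ≤ M + (K * (B + 1)) ^ 2 := by positivity
  refine (key (min 1 (ε / (M + (K * (B + 1)) ^ 2 + 1))) (by positivity) (min_le_left _ _)).trans ?_
  gcongr
  calc _ ≤ ε / (M + (K * (B + 1)) ^ 2 + 1) * (M + (K * (B + 1)) ^ 2 + 1) := by
        refine mul_le_mul (min_le_right _ _) (by linarith) hL (by positivity)
    _ = ε := by field_simp

/-! ### Minimising convex functionals on a Hilbert space. -/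

section Hilbert

theorem ofReal_mul_enorm_sq {E : Type*} [NormedAddCommGroup E] {lam : ℝ} (hlam : 0 ≤ lam) (x : E) :
    ENNReal.ofReal lam * ‖x‖ₑ ^ 2 = ENNReal.ofReal (lam * ‖x‖ ^ 2) := by
  rw [ENNReal.ofReal_mul hlam, ENNReal.ofReal_pow (norm_nonneg _), ofReal_norm]

variable {H : Type*} [NormedAddCommGroup H] [InnerProductSpace ℝ H]

/-- Uniform convexity of a midpoint convex functional plus a multiple of the squared norm. -/
theorem norm_sub_sq_le_of_midpoint_convex {Φ : H → ℝ≥0∞} {lam r : ℝ} (hlam : 0 ≤ lam)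
    (hΦ : ∀ x y, 2 * Φ ((2⁻¹ : ℝ) • (x + y)) ≤ Φ x + Φ y) {m : ℝ≥0∞} (hr : 0 ≤ r)
    (hm : ∀ x, m ≤ Φ x + ENNReal.ofReal lam * ‖x‖ₑ ^ 2) (hmtop : m ≠ ⊤) {x y : H}
    (hx : Φ x + ENNReal.ofReal lam * ‖x‖ₑ ^ 2 ≤ m + ENNReal.ofReal r)
    (hy : Φ y + ENNReal.ofReal lam * ‖y‖ₑ ^ 2 ≤ m + ENNReal.ofReal r) :
    lam * ‖x - y‖ ^ 2 ≤ 4 * r := by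
  have hbt : m + ENNReal.ofReal r ≠ ⊤ := by finiteness
  have hxt : Φ x ≠ ⊤ := ne_top_of_le_ne_top hbt (le_self_add.trans hx)
  have hyt : Φ y ≠ ⊤ := ne_top_of_le_ne_top hbt (le_self_add.trans hy)
  have hxy := hΦ x y
  have hmid := hm ((2⁻¹ : ℝ) • (x + y))
  have hmt : Φ ((2⁻¹ : ℝ) • (x + y)) ≠ ⊤ := by
    intro h
    rw [h] at hxy
    exact (ENNReal.add_ne_top.2 ⟨hxt, hyt⟩) (top_le_iff.1 (by simpa using hxy))
  simp only [ofReal_mul_enorm_sq hlam] at hx hy hmid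
  generalize Φ ((2⁻¹ : ℝ) • (x + y)) = c at *
  generalize Φ x = a at *
  generalize Φ y = b at *
  lift a to NNReal using hxt
  lift b to NNReal using hyt
  lift c to NNReal using hmt
  lift m to NNReal using hmtop
  have h0 : ∀ z : H, 0 ≤ lam * ‖z‖ ^ 2 := fun z => by positivity
  have conv : ∀ (s t : NNReal) (p q : ℝ), 0 ≤ p → 0 ≤ q →
      (s : ℝ≥0∞) + ENNReal.ofReal p ≤ t + ENNReal.ofReal q → (s : ℝ) + p ≤ t + q := by
    intro s t p q hp hq h
    rw [← ENNReal.ofReal_coe_nnreal, ← ENNReal.ofReal_coe_nnreal, ← ENNReal.ofReal_add s.coe_nonneg hp,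
      ← ENNReal.ofReal_add t.coe_nonneg hq] at h
    exact (ENNReal.ofReal_le_ofReal_iff (add_nonneg t.coe_nonneg hq)).1 h
  replace hx := conv _ _ _ _ (h0 x) hr hx
  replace hy := conv _ _ _ _ (h0 y) hr hy
  replace hmid := conv m c 0 _ le_rfl (h0 _) (by simpa only [ENNReal.ofReal_zero, add_zero] using hmid)
  have hxy' : 2 * (c : ℝ) ≤ a + b := by exact_mod_cast hxy
  -- The energy at the midpoint lies below the mean of the two energies by at least `lam * ‖x - y‖ ^
  -- 2 / 4`, yet it is at least `m`.
  have hpar := parallelogram_law_with_norm ℝ x y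
  have hn : ‖(2⁻¹ : ℝ) • (x + y)‖ ^ 2 = ‖x + y‖ ^ 2 / 4 := by
    rw [norm_smul, mul_pow]; norm_num; ring
  rw [hn] at hmid
  have : lam * ‖x - y‖ ^ 2 = lam * (2 * (‖x‖ ^ 2 + ‖y‖ ^ 2)) - lam * ‖x + y‖ ^ 2 := by
    rw [← mul_sub]; congr 1; linarith
  nlinarith

/-- A proper, lower semicontinuous, midpoint convex functional plus a positive multiple of the
squared norm has a unique minimiser. -/
theorem existsUnique_minimiser [CompleteSpace H] {Φ : H → ℝ≥0∞} {lam : ℝ} (hlam : 0 < lam)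
    (hΦ : ∀ x y, 2 * Φ ((2⁻¹ : ℝ) • (x + y)) ≤ Φ x + Φ y) (hlsc : LowerSemicontinuous Φ)
    (hfin : ∃ x, Φ x ≠ ⊤) :
    ∃! x, ∀ y, Φ x + ENNReal.ofReal lam * ‖x‖ₑ ^ 2 ≤ Φ y + ENNReal.ofReal lam * ‖y‖ₑ ^ 2 := by
  set Ψ : H → ℝ≥0∞ := fun x => Φ x + ENNReal.ofReal lam * ‖x‖ₑ ^ 2 with hΨ
  have hΨlsc : LowerSemicontinuous Ψ := by
    refine hlsc.add (Continuous.lowerSemicontinuous ?_)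
    simp only [ofReal_mul_enorm_sq hlam.le]
    exact ENNReal.continuous_ofReal.comp (by fun_prop)
  set m : ℝ≥0∞ := ⨅ x, Ψ x with hm
  have hmle : ∀ x, m ≤ Ψ x := fun x => iInf_le _ x
  have hmtop : m ≠ ⊤ := by
    obtain ⟨x, hx⟩ := hfin
    refine ne_top_of_le_ne_top ?_ (hmle x)
    simp only [hΨ]
    finiteness
  have hclose : ∀ {r : ℝ}, 0 ≤ r → ∀ {x y}, Ψ x ≤ m + ENNReal.ofReal r →
      Ψ y ≤ m + ENNReal.ofReal r → lam * ‖x - y‖ ^ 2 ≤ 4 * r := fun hr _ _ hx hy =>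
    norm_sub_sq_le_of_midpoint_convex hlam.le hΦ hr hmle hmtop hx hy
  -- Chosen so that the sublevel set at height `m + r n` has diameter at most `1 / (n + 1)`;
  -- Cantor's intersection theorem then gives the minimiser.
  let r : ℕ → ℝ := fun n => lam / 4 * (1 / ((n : ℝ) + 1)) ^ 2
  have hr : ∀ n, 0 < r n := fun n => by positivity
  let S : ℕ → Set H := fun n => {x | Ψ x ≤ m + ENNReal.ofReal (r n)}
  have hdist : ∀ n, ∀ x ∈ S n, ∀ y ∈ S n, dist x y ≤ 1 / ((n : ℝ) + 1) := fun n x hx y hy => by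
    have h := hclose (hr n).le hx hy
    rw [dist_eq_norm]
    have h' : lam * ‖x - y‖ ^ 2 ≤ lam * (1 / ((n : ℝ) + 1)) ^ 2 := by
      refine h.trans_eq ?_
      simp only [r]
      ring
    exact le_of_sq_le_sq (le_of_mul_le_mul_left h' hlam) (by positivity)
  have hanti : ∀ n k, n ≤ k → S k ⊆ S n := fun n k hnk x hx => by
    refine le_trans (show Ψ x ≤ _ from hx) ?_
    simp only [r]
    gcongr
  have hne : ∀ n, (S n).Nonempty := fun n => by
    have : m < m + ENNReal.ofReal (r n) :=
      ENNReal.lt_add_right hmtop (by simpa using hr n)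
    obtain ⟨x, hx⟩ := iInf_lt_iff.1 this
    exact ⟨x, hx.le⟩
  obtain ⟨x, hx⟩ := Metric.nonempty_iInter_of_nonempty_biInter (s := S)
    (fun n => hΨlsc.isClosed_preimage _)
    (fun n => Metric.isBounded_iff.2 ⟨_, fun x hx y hy => hdist n x hx y hy⟩)
    (fun N => by
      obtain ⟨x, hx⟩ := hne N
      exact ⟨x, Set.mem_iInter₂.2 fun n hn => hanti n N hn hx⟩)
    (squeeze_zero (fun n => Metric.diam_nonneg)
      (fun n => Metric.diam_le_of_forall_dist_le (by positivity) (hdist n))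
      tendsto_one_div_add_atTop_nhds_zero_nat)
  have hr0 : Tendsto r atTop (𝓝 0) := by
    have := (tendsto_one_div_add_atTop_nhds_zero_nat (𝕜 := ℝ)).pow 2 |>.const_mul (lam / 4)
    rwa [zero_pow two_ne_zero, mul_zero] at this
  have hxm : Ψ x ≤ m := by
    have : Tendsto (fun n => m + ENNReal.ofReal (r n)) atTop (𝓝 (m + ENNReal.ofReal 0)) :=
      (ENNReal.continuous_ofReal.tendsto 0 |>.comp hr0).const_add m
    rw [ENNReal.ofReal_zero, add_zero] at this
    exact ge_of_tendsto' this fun n => Set.mem_iInter.1 hx n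
  refine ⟨x, fun y => hxm.trans (hmle y), fun y hy => ?_⟩
  have hym : Ψ y ≤ m := (hy x).trans hxm
  have h := hclose le_rfl (x := x) (y := y) (by simpa using hxm) (by simpa using hym)
  have : ‖x - y‖ ^ 2 ≤ 0 := by nlinarith
  have h0 : ‖x - y‖ = 0 := by
    have := sq_nonneg ‖x - y‖
    exact pow_eq_zero_iff two_ne_zero |>.1 (by linarith)
  exact (sub_eq_zero.1 (norm_eq_zero.1 h0)).symm

end Hilbert

/-! ### Calculus of the total variation and the `BV` norm. -/

theorem integrable_mul_divergence {u : Plane → ℝ} (hu : LocallyIntegrable u) {φ : Plane → Plane}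
    (hφ : IsTestField φ) : Integrable (fun x => u x * divergence φ x) :=
  hu.integrable_smul_right_of_hasCompactSupport (continuous_divergence hφ.smooth)
    (hasCompactSupport_divergence hφ.compactSupport)

theorem IsTestField.neg {φ : Plane → Plane} (hφ : IsTestField φ) : IsTestField (fun x => -φ x) where
  smooth := hφ.smooth.neg
  compactSupport := hφ.compactSupport.comp_left (g := fun y => -y) neg_zero
  norm_le_one x := by rw [norm_neg]; exact hφ.norm_le_one x

theorem divergence_neg (φ : Plane → Plane) (x : Plane) :
    divergence (fun y => -φ y) x = -divergence φ x := by
  simp [divergence, fderiv_fun_neg]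

theorem ofReal_integral_mul_divergence_le (u : Img) {φ : Plane → Plane} (hφ : IsTestField φ) :
    ENNReal.ofReal (∫ x, u x * divergence φ x) ≤ totalVariation u :=
  le_iSup₂ (f := fun φ (_ : IsTestField φ) => ENNReal.ofReal (∫ x, u x * divergence φ x)) φ hφ

theorem IsBV.integrable {u : Img} (hu : IsBV u) : Integrable u := memLp_one_iff_integrable.1 hu.1

theorem IsBV.integral_mul_divergence_le {u : Img} (hu : IsBV u) {φ : Plane → Plane}
    (hφ : IsTestField φ) : ∫ x, u x * divergence φ x ≤ (totalVariation u).toReal :=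
  (ENNReal.ofReal_le_iff_le_toReal hu.2.ne).1 (ofReal_integral_mul_divergence_le u hφ)

theorem isBV_iff_bvNorm_lt_top {u : Img} : IsBV u ↔ bvNorm u < ⊤ := by
  rw [bvNorm, ENNReal.add_lt_top, IsBV, MemLp, and_iff_right u.aestronglyMeasurable]

theorem totalVariation_add_le {u v : Img} (hu : LocallyIntegrable u) (hv : LocallyIntegrable v) :
    totalVariation (u + v) ≤ totalVariation u + totalVariation v := by
  refine iSup₂_le fun φ hφ => ?_
  have e : ∫ x, (u + v) x * divergence φ x
      = (∫ x, u x * divergence φ x) + ∫ x, v x * divergence φ x := by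
    rw [← integral_add (integrable_mul_divergence hu hφ) (integrable_mul_divergence hv hφ)]
    refine integral_congr_ae ?_
    filter_upwards [AEEqFun.coeFn_add u v] with x hx
    rw [hx, Pi.add_apply, add_mul]
  rw [e]
  exact ENNReal.ofReal_add_le.trans (add_le_add (ofReal_integral_mul_divergence_le u hφ)
    (ofReal_integral_mul_divergence_le v hφ))

theorem totalVariation_neg_le (u : Img) : totalVariation (-u) ≤ totalVariation u := by
  refine iSup₂_le fun φ hφ => ?_
  refine le_trans (le_of_eq ?_) (ofReal_integral_mul_divergence_le u hφ.neg)
  congr 1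
  refine integral_congr_ae ?_
  filter_upwards [AEEqFun.coeFn_neg u] with x hx
  rw [hx, divergence_neg, Pi.neg_apply, neg_mul, mul_neg]

theorem two_mul_totalVariation_le (u : Img) :
    2 * totalVariation u ≤ totalVariation ((2 : ℝ) • u) := by
  simp only [totalVariation, ENNReal.mul_iSup]
  refine iSup₂_le fun φ hφ => ?_
  refine le_trans (le_of_eq ?_) (ofReal_integral_mul_divergence_le ((2 : ℝ) • u) hφ)
  have h2 : ∀ r : ℝ, 2 * ENNReal.ofReal r = ENNReal.ofReal (2 * r) := fun r => by
    rw [ENNReal.ofReal_mul zero_le_two, ENNReal.ofReal_ofNat]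
  rw [h2, ← integral_const_mul]
  congr 1
  refine integral_congr_ae ?_
  filter_upwards [AEEqFun.coeFn_smul (2 : ℝ) u] with x hx
  simp only [hx, Pi.smul_apply, smul_eq_mul, mul_assoc]

theorem bvNorm_add_le {u v : Img} (hu : LocallyIntegrable u) (hv : LocallyIntegrable v) :
    bvNorm (u + v) ≤ bvNorm u + bvNorm v := by
  rw [bvNorm, bvNorm, bvNorm, add_add_add_comm, eLpNorm_congr_ae (AEEqFun.coeFn_add u v)]
  exact add_le_add (eLpNorm_add_le u.aestronglyMeasurable v.aestronglyMeasurable le_rfl)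
    (totalVariation_add_le hu hv)

theorem two_mul_bvNorm_le (u : Img) : 2 * bvNorm u ≤ bvNorm ((2 : ℝ) • u) := by
  rw [bvNorm, bvNorm, mul_add, eLpNorm_congr_ae (AEEqFun.coeFn_smul (2 : ℝ) u),
    eLpNorm_const_smul]
  refine add_le_add (le_of_eq ?_) (two_mul_totalVariation_le u)
  simp [← ofReal_norm]

theorem locallyIntegrable_of_memLp_two {v : Plane → ℝ} (hv : MemLp v 2 volume) :
    LocallyIntegrable v :=
  hv.locallyIntegrable one_le_two

theorem locallyIntegrable_sub {f : Img} (hf : IsBV f) {v : Img} (hv : MemLp v 2 volume) :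
    LocallyIntegrable (f - v : Img) :=
  (hf.integrable.locallyIntegrable.sub (locallyIntegrable_of_memLp_two hv)).congr
    (AEEqFun.coeFn_sub f v).symm

theorem IsBV.sub {f u : Img} (hf : IsBV f) (hu : IsBV u) : IsBV (f - u) := by
  refine ⟨(hf.1.sub hu.1).ae_eq (AEEqFun.coeFn_sub f u).symm, ?_⟩
  have hn : LocallyIntegrable (-u : Img) :=
    hu.integrable.locallyIntegrable.neg.congr (AEEqFun.coeFn_neg u).symm
  rw [sub_eq_add_neg]
  exact (totalVariation_add_le hf.integrable.locallyIntegrable hn).trans_lt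
    (ENNReal.add_lt_top.2 ⟨hf.2, (totalVariation_neg_le u).trans_lt hu.2⟩)

theorem totalVariation_sub_le {f u : Img} (hf : IsBV f) (hu : IsBV u) :
    totalVariation (f - u) ≤ bvNorm f + bvNorm u := by
  have hn : LocallyIntegrable (-u : Img) :=
    hu.integrable.locallyIntegrable.neg.congr (AEEqFun.coeFn_neg u).symm
  rw [sub_eq_add_neg]
  refine (totalVariation_add_le hf.integrable.locallyIntegrable hn).trans
    (add_le_add le_add_self ((totalVariation_neg_le u).trans le_add_self))

theorem IsBV.memLp_two {u : Img} (hu : IsBV u) : MemLp u 2 volume :=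
  memLp_two_of_integral_mul_divergence_le hu.integrable fun _ hφ =>
    hu.integral_mul_divergence_le hφ

/-! ### The Rudin–Osher–Fatemi problem as a minimisation over `L²`. -/

/-- The functional `v ↦ ‖f - v‖_BV` on `L²`. -/
noncomputable def bvNormSub (f : Img) (v : Lp ℝ 2 (volume : Measure Plane)) : ℝ≥0∞ :=
  bvNorm (f - (v : Img))

theorem two_mul_bvNormSub_midpoint_le {f : Img} (hf : IsBV f)
    (x y : Lp ℝ 2 (volume : Measure Plane)) :
    2 * bvNormSub f ((2⁻¹ : ℝ) • (x + y)) ≤ bvNormSub f x + bvNormSub f y := by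
  refine (two_mul_bvNorm_le _).trans ?_
  have e : (2 : ℝ) • (f - (((2⁻¹ : ℝ) • (x + y) : Lp ℝ 2 (volume : Measure Plane)) : Img))
      = (f - (x : Img)) + (f - (y : Img)) := by
    have : (((2⁻¹ : ℝ) • (x + y) : Lp ℝ 2 (volume : Measure Plane)) : Img)
      = (2⁻¹ : ℝ) • ((x : Img) + (y : Img)) := rfl
    rw [this]
    module
  rw [e]
  exact bvNorm_add_le (locallyIntegrable_sub hf (Lp.memLp x))
    (locallyIntegrable_sub hf (Lp.memLp y))

/-- The `L¹` part follows from Fatou along an almost everywhere convergent subsequence. The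
variation is a supremum of functions continuous on `L²`, because `div φ` is itself in `L²`. -/
theorem lowerSemicontinuous_bvNormSub {f : Img} (hf : IsBV f) :
    LowerSemicontinuous (bvNormSub f) := by
  refine LowerSemicontinuous.add ?_ ?_
  · refine lowerSemicontinuous_iff_isClosed_preimage.2 fun c => IsSeqClosed.isClosed ?_
    intro v x hv hx
    obtain ⟨ns, -, hns⟩ := (tendstoInMeasure_of_tendsto_Lp hx).exists_seq_tendsto_ae
    refine (Lp.eLpNorm_lim_le_liminf_eLpNorm
      (f := fun n => ((f - (v (ns n) : Img) : Img) : Plane → ℝ))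
      (fun n => AEEqFun.aestronglyMeasurable _) _ ?_).trans ?_
    · have h : ∀ᵐ a, ∀ n, (f - (v (ns n) : Img) : Img) a = f a - v (ns n) a :=
        ae_all_iff.2 fun n => AEEqFun.coeFn_sub _ _
      filter_upwards [hns, h, AEEqFun.coeFn_sub f (x : Img)] with a ha h1 h2
      simp only [h1, h2, Pi.sub_apply]
      exact ha.const_sub _
    · exact liminf_le_of_frequently_le' (Frequently.of_forall fun n => hv (ns n))
  · refine lowerSemicontinuous_iSup fun φ => lowerSemicontinuous_iSup fun hφ =>
      Continuous.lowerSemicontinuous (ENNReal.continuous_ofReal.comp ?_)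
    have hd : MemLp (divergence φ) 2 volume :=
      (continuous_divergence hφ.smooth).memLp_of_hasCompactSupport
        (hasCompactSupport_divergence hφ.compactSupport)
    have e : ∀ v : Lp ℝ 2 (volume : Measure Plane),
        ∫ x, (f - (v : Img) : Img) x * divergence φ x
          = (∫ x, f x * divergence φ x) - inner ℝ hd.toLp v := fun v => by
      rw [L2.inner_def, ← integral_sub
        (integrable_mul_divergence hf.integrable.locallyIntegrable hφ) (L2.integrable_inner _ _)]
      refine integral_congr_ae ?_
      filter_upwards [AEEqFun.coeFn_sub f (v : Img), hd.coeFn_toLp] with x h1 h2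
      rw [h1, h2, Pi.sub_apply, sub_mul]
      rfl
    simp only [e]
    fun_prop

/-- The constraint `u ∈ BV` is encoded by the value `⊤` of `bvNormSub`, leaving an unconstrained
problem in `v`. -/
theorem isROFOptimal_iff {lam : ℝ} {f u v : Img} (hf : IsBV f) :
    IsROFOptimal lam f u v ↔ ∃ x : Lp ℝ 2 (volume : Measure Plane), (x : Img) = v ∧ u = f - v ∧
      ∀ y, bvNormSub f x + ENNReal.ofReal lam * ‖x‖ₑ ^ 2
        ≤ bvNormSub f y + ENNReal.ofReal lam * ‖y‖ₑ ^ 2 := by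
  constructor
  · rintro ⟨⟨hu, hv, h⟩, hopt⟩
    have hu' : u = f - v := by rw [h, add_sub_cancel_right]
    refine ⟨⟨v, Lp.mem_Lp_iff_memLp.2 hv⟩, rfl, hu', fun y => ?_⟩
    rw [Lp.enorm_def, Lp.enorm_def]
    subst hu'
    by_cases hy : bvNormSub f y = ⊤
    · simp [hy]
    · exact hopt _ _ ⟨isBV_iff_bvNorm_lt_top.2 (lt_top_iff_ne_top.2 hy), Lp.memLp y,
        (sub_add_cancel _ _).symm⟩
  · rintro ⟨x, rfl, rfl, hx⟩
    refine ⟨⟨isBV_iff_bvNorm_lt_top.2 ?_, Lp.memLp x, (sub_add_cancel _ _).symm⟩, ?_⟩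
    · refine (le_self_add.trans (hx 0)).trans_lt ?_
      have h0 : bvNormSub f 0 = bvNorm f := congrArg bvNorm (sub_zero f)
      simpa [h0] using isBV_iff_bvNorm_lt_top.1 hf
    · rintro u' v' ⟨hu', hv', rfl⟩
      have h := hx ⟨v', Lp.mem_Lp_iff_memLp.2 hv'⟩
      rw [Lp.enorm_def, Lp.enorm_def] at h
      refine h.trans (le_of_eq ?_)
      simp only [bvNormSub, add_sub_cancel_right, rofEnergy]

theorem existsUnique_isROFOptimal {lam : ℝ} (hlam : 0 < lam) {f : Img} (hf : IsBV f) :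
    ∃! d : Img × Img, IsROFOptimal lam f d.1 d.2 := by
  have h0 : bvNormSub f 0 = bvNorm f := congrArg bvNorm (sub_zero f)
  obtain ⟨x, hx, huniq⟩ := existsUnique_minimiser hlam (two_mul_bvNormSub_midpoint_le hf)
    (lowerSemicontinuous_bvNormSub hf) ⟨0, by rw [h0]; exact (isBV_iff_bvNorm_lt_top.1 hf).ne⟩
  refine ⟨(f - (x : Img), (x : Img)), (isROFOptimal_iff hf).2 ⟨x, rfl, rfl, hx⟩, ?_⟩
  rintro ⟨u, v⟩ h
  obtain ⟨y, rfl, hu, hy⟩ := (isROFOptimal_iff hf).1 h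
  rw [← huniq y hy, ← show u = f - (y : Img) from hu]

/-! ### Decompositions as identities of tempered distributions. -/

theorem isDistribDiv_zero : IsDistribDiv 0 0 := fun φ => by
  have : ∫ x, fderiv ℝ φ x ((0 : Lp Plane ⊤ (volume : Measure Plane)) x) = 0 := by
    refine integral_eq_zero_of_ae ?_
    filter_upwards [Lp.coeFn_zero Plane ⊤ (volume : Measure Plane)] with x hx
    rw [hx]
    simp
  rw [this]
  simp

theorem gNorm_zero : gNorm 0 = 0 :=
  le_antisymm (iInf₂_le_of_le 0 isDistribDiv_zero (by simp)) zero_le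

theorem energy_zero (lam mu : ℝ) (u v : Img) : energy lam mu u v 0 = rofEnergy lam u v := by
  rw [energy, gNorm_zero, mul_zero, add_zero, rofEnergy]

theorem integrable_mul_schwartz_of_isBV {u : Img} (hu : IsBV u) (φ : 𝓢(Plane, ℝ)) :
    Integrable (fun x => u x * φ x) := by
  obtain ⟨C, hC⟩ := φ.toBoundedContinuousFunction.isBounded_range.exists_norm_le
  exact hu.integrable.mul_bdd (c := C) φ.continuous.aestronglyMeasurable
    (Eventually.of_forall fun x => hC _ ⟨x, rfl⟩)

theorem integrable_mul_schwartz_of_memLp {v : Img} (hv : MemLp v 2 volume) (φ : 𝓢(Plane, ℝ)) :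
    Integrable (fun x => v x * φ x) :=
  hv.integrable_mul (φ.memLp 2)

theorem IsROFDecomposition.isDecomposition {f u v : Img} (h : IsROFDecomposition f u v) :
    IsDecomposition f u v 0 where
  bv := h.bv
  memLp := h.memLp
  memG := ⟨0, isDistribDiv_zero⟩
  sum_eq φ := by
    rw [zero_apply, add_zero,
      ← integral_add (integrable_mul_schwartz_of_isBV h.bv φ)
        (integrable_mul_schwartz_of_memLp h.memLp φ), h.sum_eq]
    refine integral_congr_ae ?_
    filter_upwards [AEEqFun.coeFn_add u v] with x hx
    rw [hx, Pi.add_apply, add_mul]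

theorem isROFDecomposition_sub {f u : Img} (hf : IsBV f) (hu : IsBV u) :
    IsROFDecomposition f u (f - u) :=
  ⟨hu, (hf.sub hu).memLp_two, (add_sub_cancel _ _).symm⟩

theorem isROFDecomposition_self {f : Img} (hf : IsBV f) : IsROFDecomposition f f 0 :=
  sub_self f ▸ isROFDecomposition_sub hf hf

theorem rofEnergy_self (lam : ℝ) (f : Img) : rofEnergy lam f 0 = bvNorm f := by
  simp [rofEnergy, eLpNorm_congr_ae AEEqFun.coeFn_zero]

/-- The third component of a decomposition acts by integration against `f - u - v`. -/
theorem IsDecomposition.apply_eq {f u v : Img} {w : Tempered} (hf : IsBV f)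
    (h : IsDecomposition f u v w) (φ : 𝓢(Plane, ℝ)) :
    w φ = ∫ x, (f - u - v : Img) x * φ x := by
  have h1 := integrable_mul_schwartz_of_isBV hf φ
  have h2 := integrable_mul_schwartz_of_isBV h.bv φ
  have h3 := integrable_mul_schwartz_of_memLp h.memLp φ
  have e : ∫ x, (f - u - v : Img) x * φ x
      = (∫ x, f x * φ x) - (∫ x, u x * φ x) - ∫ x, v x * φ x := by
    rw [← integral_sub h1 h2, ← integral_sub (by exact h1.sub h2) h3]
    refine integral_congr_ae ?_
    filter_upwards [AEEqFun.coeFn_sub (f - u) v, AEEqFun.coeFn_sub f u] with x hx hx'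
    simp only [hx, hx', Pi.sub_apply, sub_mul]
  rw [e, h.sum_eq φ]
  ring

/-! ### The pairing of `BV` with `G`. -/

theorem ae_norm_le_norm (F : Lp Plane ⊤ (volume : Measure Plane)) : ∀ᵐ x, ‖F x‖ ≤ ‖F‖ := by
  filter_upwards [ae_le_eLpNormEssSup (f := F) (μ := volume)] with x hx
  rw [← eLpNorm_exponent_top, ← Lp.enorm_def, enorm_le_iff_norm_le] at hx
  exact hx

theorem IsDistribDiv.apply_le {w : Tempered} {F : Lp Plane ⊤ (volume : Measure Plane)}
    (h : IsDistribDiv w F) {φ : 𝓢(Plane, ℝ)} (hφ : HasCompactSupport φ) :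
    w φ ≤ ‖F‖ * ∫ x, ‖fderiv ℝ φ x‖ := by
  have hc : Continuous (fderiv ℝ φ) := (φ.smooth ⊤).continuous_fderiv (by simp)
  have hi := (hc.integrable_of_hasCompactSupport (μ := volume) (hφ.fderiv ℝ)).norm
  rw [h φ, ← integral_const_mul]
  refine (neg_le_abs _).trans ?_
  rw [← Real.norm_eq_abs]
  refine norm_integral_le_of_norm_le (hi.const_mul _) ?_
  filter_upwards [ae_norm_le_norm F] with x hx
  rw [mul_comm]
  exact ((fderiv ℝ φ x).le_opNorm _).trans (mul_le_mul_of_nonneg_left hx (norm_nonneg _))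

/-- The duality estimate `∫ g w ≤ |Dg| ‖w‖_G`. -/
theorem ofReal_integral_mul_le_totalVariation_mul_gNorm {g W : Img} {w : Tempered} (hg : IsBV g)
    (hW : MemLp W 2 volume) (hwG : IsG w) (hw : ∀ φ : 𝓢(Plane, ℝ), w φ = ∫ x, W x * φ x) :
    ENNReal.ofReal (∫ x, W x * g x) ≤ totalVariation g * gNorm w := by
  have hF : ∀ F, IsDistribDiv w F →
      ENNReal.ofReal (∫ x, W x * g x) ≤ totalVariation g * ‖F‖ₑ := fun F hF => by
    have h := integral_mul_le_of_forall_smooth hg.integrable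
      (fun φ hφ => hg.integral_mul_divergence_le hφ) hW (norm_nonneg F) fun h hs hc => by
        have := hF.apply_le (φ := hc.toSchwartzMap hs) hc
        rw [hw] at this
        exact this
    refine (ENNReal.ofReal_le_ofReal h).trans (le_of_eq ?_)
    rw [ENNReal.ofReal_mul (norm_nonneg _), ENNReal.ofReal_toReal hg.2.ne, ofReal_norm, mul_comm]
  simp only [gNorm]
  -- Passing to the infimum over `F` divides by `|Dg|`; when `|Dg| = 0`, a single admissible `F`
  -- suffices.
  by_cases h0 : totalVariation g = 0
  · obtain ⟨F, h⟩ := hwG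
    simpa [h0] using hF F h
  · rw [← ENNReal.div_le_iff' h0 hg.2.ne]
    exact le_iInf₂ fun F h => ENNReal.div_le_of_le_mul' (hF F h)

/-! ### Comparison of the two energies. -/

/-- Absorbing the oscillating part into the `L²` part decreases the energy. -/
theorem IsDecomposition.rofEnergy_add_le_energy {lam mu : ℝ} (hlam : 0 < lam)
    (hmu : 0 < mu) {f u v : Img} {w : Tempered} (hf : IsBV f)
    (hfmu : bvNorm f ≤ ENNReal.ofReal (mu / (4 * lam))) (h : IsDecomposition f u v w)
    (hu : bvNorm u ≤ bvNorm f) :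
    rofEnergy lam u (f - u) + ENNReal.ofReal lam * eLpNorm (f - u - v : Img) 2 volume ^ 2
      ≤ energy lam mu u v w := by
  set g : Img := f - u with hgdef
  set W : Img := g - v with hWdef
  have hg : IsBV g := hf.sub h.bv
  have hg2 := hg.memLp_two
  have hW : MemLp W 2 volume := (hg2.sub h.memLp).ae_eq (AEEqFun.coeFn_sub g v).symm
  have hdual := ofReal_integral_mul_le_totalVariation_mul_gNorm hg hW h.memG (h.apply_eq hf)
  have hWg : Integrable (fun x => W x * g x) := hW.integrable_mul hg2
  have hid : (∫ x, g x ^ 2) + ∫ x, W x ^ 2 = (∫ x, v x ^ 2) + 2 * ∫ x, W x * g x := by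
    rw [← integral_add hg2.integrable_sq hW.integrable_sq, ← integral_const_mul,
      ← integral_add h.memLp.integrable_sq (hWg.const_mul 2)]
    refine integral_congr_ae ?_
    filter_upwards [AEEqFun.coeFn_sub g v] with x hx
    simp only [hWdef, hx, Pi.sub_apply]
    ring
  have hT : totalVariation g ≤ 2 * ENNReal.ofReal (mu / (4 * lam)) := by
    refine (totalVariation_sub_le hf h.bv).trans ?_
    rw [two_mul]
    exact add_le_add hfmu (hu.trans hfmu)
  -- One factor `2` comes from the cross term of the square, the other from bounding `|Dg|` by two
  -- `BV` norms; together they account for the `4` in the hypothesis on `f`.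
  have hcoef : ENNReal.ofReal lam * (2 * (2 * ENNReal.ofReal (mu / (4 * lam))))
      = ENNReal.ofReal mu := by
    have h2 : ∀ r : ℝ, 2 * ENNReal.ofReal r = ENNReal.ofReal (2 * r) := fun r => by
      rw [ENNReal.ofReal_mul zero_le_two, ENNReal.ofReal_ofNat]
    rw [h2, h2, ← ENNReal.ofReal_mul hlam.le]
    congr 1
    field_simp
    norm_num
  have hL2 : eLpNorm g 2 volume ^ 2 + eLpNorm W 2 volume ^ 2
      ≤ eLpNorm v 2 volume ^ 2 + 2 * (totalVariation g * gNorm w) := by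
    have h2 : ∀ r : ℝ, 2 * ENNReal.ofReal r = ENNReal.ofReal (2 * r) := fun r => by
      rw [ENNReal.ofReal_mul zero_le_two, ENNReal.ofReal_ofNat]
    have hnn : ∀ k : Img, 0 ≤ ∫ x, k x ^ 2 := fun k => integral_nonneg fun x => sq_nonneg _
    rw [eLpNorm_two_sq_eq_ofReal hg2, eLpNorm_two_sq_eq_ofReal hW,
      eLpNorm_two_sq_eq_ofReal h.memLp, ← ENNReal.ofReal_add (hnn g) (hnn W), hid]
    refine ENNReal.ofReal_add_le.trans ?_
    rw [← h2]
    gcongr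
  calc rofEnergy lam u g + ENNReal.ofReal lam * eLpNorm W 2 volume ^ 2
      = bvNorm u + ENNReal.ofReal lam * (eLpNorm g 2 volume ^ 2 + eLpNorm W 2 volume ^ 2) := by
        rw [rofEnergy, mul_add, add_assoc]
    _ ≤ bvNorm u + ENNReal.ofReal lam * (eLpNorm v 2 volume ^ 2
          + 2 * ((2 * ENNReal.ofReal (mu / (4 * lam))) * gNorm w)) := by
        refine add_le_add le_rfl (mul_le_mul_right (hL2.trans ?_) _)
        gcongr
    _ = energy lam mu u v w := by
        rw [energy, ← hcoef]
        ring

theorem IsROFOptimal.isOptimal {lam mu : ℝ} (hlam : 0 < lam) (hmu : 0 < mu) {f u v : Img}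
    (hf : IsBV f) (hfmu : bvNorm f ≤ ENNReal.ofReal (mu / (4 * lam)))
    (h : IsROFOptimal lam f u v) : IsOptimal lam mu f u v 0 := by
  refine ⟨h.1.isDecomposition, fun u' v' w' h' => ?_⟩
  rw [energy_zero]
  by_cases hu : bvNorm u' ≤ bvNorm f
  · exact (h.2 _ _ (isROFDecomposition_sub hf h'.bv)).trans
      (le_self_add.trans (h'.rofEnergy_add_le_energy hlam hmu hf hfmu hu))
  -- Here `u'` alone costs more than the competitor `(f, 0)`, so the duality estimate is not needed.
  · refine (h.2 _ _ (isROFDecomposition_self hf)).trans ?_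
    rw [rofEnergy_self, energy, add_assoc]
    exact (not_le.1 hu).le.trans le_self_add

theorem IsOptimal.eq_zero_and_isROFOptimal {lam mu : ℝ} (hlam : 0 < lam) (hmu : 0 < mu)
    {f u v : Img} {w : Tempered} (hf : IsBV f)
    (hfmu : bvNorm f ≤ ENNReal.ofReal (mu / (4 * lam))) (h : IsOptimal lam mu f u v w) :
    w = 0 ∧ IsROFOptimal lam f u v := by
  have hself := h.2 _ _ _ (isROFDecomposition_self hf).isDecomposition
  rw [energy_zero, rofEnergy_self] at hself
  have hu : bvNorm u ≤ bvNorm f := by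
    refine le_trans ?_ hself
    rw [energy, add_assoc]
    exact le_self_add
  have hrof := isROFDecomposition_sub hf h.1.bv
  have hle := h.1.rofEnergy_add_le_energy hlam hmu hf hfmu hu
  have hle' := h.2 _ _ _ hrof.isDecomposition
  rw [energy_zero] at hle'
  -- Finiteness permits cancelling this energy from the two opposite inequalities, which leaves `lam
  -- * ‖W‖² = 0`.
  have hfin : rofEnergy lam u (f - u) ≠ ⊤ :=
    ((le_self_add.trans (hle.trans hself)).trans_lt (isBV_iff_bvNorm_lt_top.1 hf)).ne
  have hzero : ENNReal.ofReal lam * eLpNorm (f - u - v : Img) 2 volume ^ 2 = 0 := by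
    have := (ENNReal.add_le_add_iff_left hfin).1
      ((hle.trans hle').trans_eq (add_zero _).symm)
    exact le_zero_iff.1 this
  have hW : f - u - v = 0 := by
    have h0 : eLpNorm (f - u - v : Img) 2 volume = 0 := by simpa [hlam.not_ge] using hzero
    rw [eLpNorm_eq_zero_iff (AEEqFun.aestronglyMeasurable _) two_ne_zero] at h0
    exact AEEqFun.ext (h0.trans AEEqFun.coeFn_zero.symm)
  have hw : w = 0 := by
    ext φ
    rw [h.1.apply_eq hf, hW]
    refine integral_eq_zero_of_ae ?_
    filter_upwards [AEEqFun.coeFn_zero (α := Plane) (β := ℝ) (μ := volume)] with x hx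
    simp [hx]
  subst hw
  rw [← sub_eq_zero.1 hW]
  rw [← sub_eq_zero.1 hW] at h
  refine ⟨rfl, hrof, fun u' v' h' => ?_⟩
  have := h.2 _ _ _ h'.isDecomposition
  rwa [energy_zero, energy_zero] at this

end ImageDecomposition

theorem mainTheorem3 (lam mu : ℝ) (hlam : 0 < lam) (hmu : 0 < mu)
    (f : ImageDecomposition.Img) (hf : ImageDecomposition.IsBV f)
    (hfmu : ImageDecomposition.bvNorm f ≤ ENNReal.ofReal (mu / (4 * lam))) :
    (∃! d : ImageDecomposition.Img × ImageDecomposition.Img × ImageDecomposition.Tempered,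
      ImageDecomposition.IsOptimal lam mu f d.1 d.2.1 d.2.2) ∧
    (∃! d : ImageDecomposition.Img × ImageDecomposition.Img,
      ImageDecomposition.IsROFOptimal lam f d.1 d.2) ∧
    ∀ (u v : ImageDecomposition.Img) (w : ImageDecomposition.Tempered),
      ImageDecomposition.IsOptimal lam mu f u v w ↔
        w = 0 ∧ ImageDecomposition.IsROFOptimal lam f u v := by
  have hiff : ∀ (u v : ImageDecomposition.Img) (w : ImageDecomposition.Tempered),
      ImageDecomposition.IsOptimal lam mu f u v w ↔
        w = 0 ∧ ImageDecomposition.IsROFOptimal lam f u v := fun u v w =>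
    ⟨fun h => h.eq_zero_and_isROFOptimal hlam hmu hf hfmu, fun h => by
      rw [h.1]
      exact h.2.isOptimal hlam hmu hf hfmu⟩
  have hrof := ImageDecomposition.existsUnique_isROFOptimal hlam hf
  refine ⟨?_, hrof, hiff⟩
  obtain ⟨⟨u, v⟩, h, huniq⟩ := hrof
  refine ⟨(u, v, 0), (hiff u v 0).2 ⟨rfl, h⟩, ?_⟩
  rintro ⟨u', v', w'⟩ h'
  obtain ⟨hw, h''⟩ := (hiff u' v' w').1 h'
  have := huniq (u', v') h''
  simp only [Prod.mk.injEq] at this ⊢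
  exact ⟨this.1, this.2, hw⟩
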